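/- Let $X$ be a real Euclidean space (a finite-dimensional real inner product space), and let $A,B\colon X\rightrightarrows X$ be set-valued operators. Write $\operatorname{gr}A=\{(x,x^*): x^*\in Ax\}$, $\operatorname{dom}A=\{x: Ax\neq\varnothing\}$, $\operatorname{ran}A=\bigcup_{x\in X}Ax$, and $(A+B)x=Ax+Bx$ (Minkowski sum). The operator $A$ is monotone if $\langle x-y,x^*-y^*\rangle\ge 0$ for all $(x,x^*),(y,y^*)\in\operatorname{gr}A$, and maximally monotone if it is monotone and its graph is not properly contained in the graph of another monotone operator. A monotone operator $A$ is rectangular if for all $x\in\operatorname{dom}A$ and $x^*\in\operatorname{ran}A$ $$F_A(x,x^*)=\sup_{(a,a^*)\in\operatorname{gr}A}\big(\langle x,a^*\rangle+\langle a,x^*\rangle-\langle a,a^*\rangle\big)<+\infty .$$ A set $S\subseteq X$ is nearly convex if there is a convex set $C\subseteq X$ with $C\subseteq S\subseteq\overline{C}$. Sets $S,T\subseteq X$ are nearly equal, written $S\approx T$, if $\overline S=\overline T$ and $\operatorname{ri}S=\operatorname{ri}T$, where $\operatorname{ri}$ denotes the interior relative to the affine hull. **Theorem.** Let $A$ and $B$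 be monotone on $X$ such that $A+B$ is maximally monotone. Suppose that one of the following holds: 1. $A$ and $B$ are rectangular; 2. $\operatorname{dom}A\subseteq\operatorname{dom}B$ and $B$ is rectangular. Then $\operatorname{ran}(A+B)$ is nearly convex, and $\operatorname{ran}(A+B)\approx\operatorname{ran}A+\operatorname{ran}B$. -/

import Mathlib

open scoped Pointwise InnerProductSpace

noncomputable section

namespace SetValued

variable {X : Type*} [NormedAddCommGroup X] [InnerProductSpace ℝ X]

/-- The graph of a set-valued operator on `X`. -/
def graph (A : X → Set X) : Set (X × X) := {p | p.2 ∈ A p.1}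

/-- The domain `{x | A x ≠ ∅}`. -/
def dom (A : X → Set X) : Set X := {x | (A x).Nonempty}

/-- The range `⋃ x, A x`. -/
def ran (A : X → Set X) : Set X := ⋃ x, A x

/-- Monotonicity of a set-valued operator. -/
def IsMonotone (A : X → Set X) : Prop :=
  ∀ p ∈ graph A, ∀ q ∈ graph A, 0 ≤ ⟪p.1 - q.1, p.2 - q.2⟫_ℝ

/-- A monotone operator without proper monotone extension. -/
def IsMaximallyMonotone (A : X → Set X) : Prop :=
  IsMonotone A ∧ ∀ B : X → Set X, IsMonotone B → graph A ⊆ graph B → graph B = graph A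

/-- The Fitzpatrick function
`F_A (x, u) = sup {⟪x, v⟫ + ⟪a, u⟫ - ⟪a, v⟫ | (a, v) ∈ graph A}`, with extended real values. -/
def fitzpatrick (A : X → Set X) (z : X × X) : EReal :=
  ⨆ p ∈ graph A, ((⟪z.1, p.2⟫_ℝ + ⟪p.1, z.2⟫_ℝ - ⟪p.1, p.2⟫_ℝ : ℝ) : EReal)

/-- `dom A × ran A ⊆ dom F_A`: the property that makes a monotone operator rectangular
(star-monotone, `3*` monotone). -/
def IsRectangular (A : X → Set X) : Prop :=
  dom A ×ˢ ran A ⊆ {z | fitzpatrick A z < ⊤}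

/-- Equal closures and equal relative interiors. -/
def NearlyEqual (S T : Set X) : Prop :=
  closure S = closure T ∧ intrinsicInterior ℝ S = intrinsicInterior ℝ T

/-- There is a convex `C` with `C ⊆ S ⊆ closure C`. -/
def NearlyConvex (S : Set X) : Prop :=
  ∃ C : Set X, Convex ℝ C ∧ C ⊆ S ∧ S ⊆ closure C

end SetValued

end

open scoped Pointwise InnerProductSpace Topology

namespace SetValued

/-! ### Relative interiors of convex sets -/

section RelativeInterior

variable {E : Type*} [NormedAddCommGroup E] [NormedSpace ℝ E] {s t : Set E} {x y : E}

/-! Let `D` be the projection of the domain of `F_{A+B}` to the range space (`fitzpatrickRange`). It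
is convex, and `ri D ⊆ ran (A + B) ⊆ ran A + ran B ⊆ D`. A set between `ri D` and `D` has the
closure and relative interior of `D`, which gives both claims. The last inclusion is where
rectangularity enters: `F_{A+B} (x, u + v) ≤ F_A (x, u) + F_B (x, v)`. The first,
`IsMaximallyMonotone.intrinsicInterior_fitzpatrickRange_subset`, uses only maximality: Minty's
theorem solves `w ∈ M x + ε x`, Fitzpatrick bounds control the solutions as `ε → 0`, and the graph
of `M` is closed. -/

theorem mem_intrinsicInterior_iff_ball :
    x ∈ intrinsicInterior ℝ s ↔
      x ∈ affineSpan ℝ s ∧ ∃ r > 0, ∀ u ∈ affineSpan ℝ s, dist u x < r → u ∈ s := by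
  rw [mem_intrinsicInterior]
  constructor
  · rintro ⟨y, hy, rfl⟩
    obtain ⟨r, hr, h⟩ := Metric.mem_nhds_iff.1 (mem_interior_iff_mem_nhds.1 hy)
    exact ⟨y.2, r, hr, fun u hu hd => @h ⟨u, hu⟩ (by simpa [Metric.mem_ball, Subtype.dist_eq])⟩
  · rintro ⟨hx, r, hr, h⟩
    refine ⟨⟨x, hx⟩, mem_interior_iff_mem_nhds.2 (Metric.mem_nhds_iff.2 ⟨r, hr, ?_⟩), rfl⟩
    intro u hu
    exact h u u.2 (by simpa [Metric.mem_ball, Subtype.dist_eq] using hu)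

theorem intrinsicInterior_mono_of_affineSpan_eq (hst : s ⊆ t)
    (h : affineSpan ℝ s = affineSpan ℝ t) : intrinsicInterior ℝ s ⊆ intrinsicInterior ℝ t := by
  intro x hx
  rw [mem_intrinsicInterior_iff_ball] at hx ⊢
  obtain ⟨hx, r, hr, hb⟩ := hx
  exact ⟨h ▸ hx, r, hr, fun u hu hd => hst (hb u (h ▸ hu) hd)⟩

/-- A half-open segment from a point of a convex set to a relative interior point stays in the
relative interior. -/
theorem lineMap_mem_intrinsicInterior (hs : Convex ℝ s) (hx : x ∈ s)
    (hy : y ∈ intrinsicInterior ℝ s) {c : ℝ} (hc : 0 < c) (hc1 : c ≤ 1) :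
    AffineMap.lineMap x y c ∈ intrinsicInterior ℝ s := by
  rw [mem_intrinsicInterior_iff_ball] at hy ⊢
  obtain ⟨hya, r, hr, hb⟩ := hy
  have hxa := subset_affineSpan ℝ s hx
  refine ⟨AffineMap.lineMap_mem c hxa hya, c * r, by positivity, fun u hu hd => ?_⟩
  -- The homothety of centre `x` and ratio `c⁻¹` carries the ball of radius `c * r` around the new
  -- point onto the `r`-ball around `y`.
  have hz : AffineMap.lineMap x u c⁻¹ ∈ s := by
    refine hb _ (AffineMap.lineMap_mem _ hxa hu) ?_
    have : AffineMap.lineMap x u c⁻¹ - y = c⁻¹ • (u - AffineMap.lineMap x y c) := by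
      simp only [AffineMap.lineMap_apply_module']
      match_scalars <;> field_simp
      ring
    rw [dist_eq_norm] at hd ⊢
    rw [this, norm_smul, Real.norm_of_nonneg (by positivity), inv_mul_lt_iff₀ hc]
    exact hd
  have hu' : u = AffineMap.lineMap x (AffineMap.lineMap x u c⁻¹) c := by
    simp only [AffineMap.lineMap_apply_module']
    match_scalars <;> field_simp
    ring
  rw [hu']
  exact hs.lineMap_mem hx hz ⟨hc.le, hc1⟩

theorem convex_intrinsicInterior (hs : Convex ℝ s) : Convex ℝ (intrinsicInterior ℝ s) := by
  intro x hx y hy a b ha hb hab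
  rcases hb.eq_or_lt with rfl | hb'
  · obtain rfl : a = 1 := by linarith
    simpa using hx
  · have := lineMap_mem_intrinsicInterior hs (intrinsicInterior_subset hx) hy hb' (by linarith)
    rwa [AffineMap.lineMap_apply_module, show 1 - b = a by linarith] at this

theorem subset_closure_intrinsicInterior [FiniteDimensional ℝ E] (hs : Convex ℝ s) :
    s ⊆ closure (intrinsicInterior ℝ s) := by
  intro x hx
  obtain ⟨y, hy⟩ := Set.Nonempty.intrinsicInterior hs ⟨x, hx⟩
  have hlim : Filter.Tendsto (fun c : ℝ => AffineMap.lineMap x y c) (𝓝[>] 0) (𝓝 x) := by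
    have : Continuous fun c : ℝ => AffineMap.lineMap (k := ℝ) x y c :=
      AffineMap.lineMap_continuous
    simpa using (this.tendsto 0).mono_left nhdsWithin_le_nhds
  refine mem_closure_of_tendsto hlim ?_
  filter_upwards [Ioc_mem_nhdsGT (zero_lt_one' ℝ)] with c hc
  exact lineMap_mem_intrinsicInterior hs hx hy hc.1 hc.2

theorem affineSpan_intrinsicInterior [FiniteDimensional ℝ E] (hs : Convex ℝ s) :
    affineSpan ℝ (intrinsicInterior ℝ s) = affineSpan ℝ s := by
  refine le_antisymm (affineSpan_mono ℝ intrinsicInterior_subset) (affineSpan_le.2 ?_)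
  exact (subset_closure_intrinsicInterior hs).trans
    (closure_minimal (subset_affineSpan ℝ _) (AffineSubspace.closed_of_finiteDimensional _))

/-- Density of the relative interior forces equal affine hulls; a relative ball contained in `s`
consists of relative interior points, hence lies in `t`. -/
theorem intrinsicInterior_eq_of_subset_of_subset [FiniteDimensional ℝ E] (hs : Convex ℝ s)
    (h₁ : intrinsicInterior ℝ s ⊆ t) (h₂ : t ⊆ s) :
    intrinsicInterior ℝ t = intrinsicInterior ℝ s := by
  have hspan : affineSpan ℝ t = affineSpan ℝ s :=
    le_antisymm (affineSpan_mono ℝ h₂)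
      ((affineSpan_intrinsicInterior hs).symm.le.trans (affineSpan_mono ℝ h₁))
  refine (intrinsicInterior_mono_of_affineSpan_eq h₂ hspan).antisymm fun x hx => ?_
  obtain ⟨hxa, r, hr, hb⟩ := mem_intrinsicInterior_iff_ball.1 hx
  refine mem_intrinsicInterior_iff_ball.2 ⟨hspan ▸ hxa, r, hr, fun u hu hd => h₁ ?_⟩
  refine mem_intrinsicInterior_iff_ball.2
    ⟨hspan ▸ hu, r - dist u x, by linarith, fun v hv hvd => hb v hv ?_⟩
  linarith [dist_triangle v u x]

theorem closure_eq_of_intrinsicInterior_subset [FiniteDimensional ℝ E] (hs : Convex ℝ s)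
    (h₁ : intrinsicInterior ℝ s ⊆ t) (h₂ : t ⊆ s) : closure t = closure s :=
  (closure_mono h₂).antisymm (closure_minimal
    ((subset_closure_intrinsicInterior hs).trans (closure_mono h₁)) isClosed_closure)

end RelativeInterior

/-! ### Maximality and closedness of the graph -/

section Monotone

variable {X : Type*} [NormedAddCommGroup X] [InnerProductSpace ℝ X] {A B M : X → Set X}

theorem IsMaximallyMonotone.mem_of_monotonically_related (hM : IsMaximallyMonotone M) {x u : X}
    (h : ∀ p ∈ graph M, 0 ≤ ⟪x - p.1, u - p.2⟫_ℝ) : u ∈ M x := by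
  let N : X → Set X := fun z => M z ∪ {v | z = x ∧ v = u}
  have hN : IsMonotone N := by
    rintro ⟨p, p'⟩ (hp | ⟨h1, h2⟩) ⟨q, q'⟩ (hq | ⟨h3, h4⟩)
    · exact hM.1 _ hp _ hq
    · simp only at h3 h4
      subst h3 h4
      have := h _ hp
      rwa [← neg_sub, ← neg_sub q', inner_neg_neg]
    · simp only at h1 h2
      subst h1 h2
      exact h _ hq
    · simp only at h1 h2 h3 h4
      simp [h1, h2, h3, h4]
  have hg := hM.2 N hN fun p hp => Or.inl hp
  have : (x, u) ∈ graph N := Or.inr ⟨rfl, rfl⟩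
  rwa [hg] at this

theorem IsMaximallyMonotone.graph_nonempty (hM : IsMaximallyMonotone M) :
    (graph M).Nonempty := by
  by_contra h
  rw [Set.not_nonempty_iff_eq_empty] at h
  have : (0 : X) ∈ M 0 := hM.mem_of_monotonically_related (by simp [h])
  exact (Set.ext_iff.1 h (0, 0)).1 this

theorem IsMaximallyMonotone.mem_of_tendsto (hM : IsMaximallyMonotone M) {x u : ℕ → X} {a b : X}
    (hx : Filter.Tendsto x Filter.atTop (𝓝 a)) (hu : Filter.Tendsto u Filter.atTop (𝓝 b))
    (h : ∀ n, u n ∈ M (x n)) : b ∈ M a := by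
  refine hM.mem_of_monotonically_related fun p hp => ?_
  exact ge_of_tendsto' ((hx.sub_const p.1).inner (hu.sub_const p.2))
    fun n => hM.1 (x n, u n) (h n) p hp

/-! ### Minty's theorem by a minimax argument -/

/-- Chebyshev's sum inequality for a finite monotone family. -/
theorem inner_sum_le_sum_inner {ι : Type*} [Fintype ι] (p q : ι → X) (c : ι → ℝ)
    (hc : c ∈ stdSimplex ℝ ι) (h : ∀ i j, 0 ≤ ⟪p i - p j, q i - q j⟫_ℝ) :
    ⟪∑ i, c i • p i, ∑ i, c i • q i⟫_ℝ ≤ ∑ i, c i * ⟪p i, q i⟫_ℝ := by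
  have h0 : 0 ≤ ∑ i, ∑ j, c i * c j * ⟪p i - p j, q i - q j⟫_ℝ :=
    Finset.sum_nonneg fun i _ => Finset.sum_nonneg fun j _ =>
      mul_nonneg (mul_nonneg (hc.1 i) (hc.1 j)) (h i j)
  have e : ∀ i j, c i * c j * ⟪p i - p j, q i - q j⟫_ℝ =
      (c i * ⟪p i, q i⟫_ℝ) * c j + c i * (c j * ⟪p j, q j⟫_ℝ)
        - c i * c j * ⟪p i, q j⟫_ℝ - c j * c i * ⟪p j, q i⟫_ℝ := by
    intro i j
    simp only [inner_sub_left, inner_sub_right]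
    ring
  have e1 : ∑ i, ∑ j, (c i * ⟪p i, q i⟫_ℝ) * c j = ∑ i, c i * ⟪p i, q i⟫_ℝ := by
    simp only [← Finset.mul_sum, hc.2, mul_one]
  have e2 : ∑ i, ∑ j, c i * (c j * ⟪p j, q j⟫_ℝ) = ∑ i, c i * ⟪p i, q i⟫_ℝ := by
    simp only [← Finset.mul_sum, ← Finset.sum_mul, hc.2, one_mul]
  have e3 : ⟪∑ i, c i • p i, ∑ i, c i • q i⟫_ℝ = ∑ i, ∑ j, c i * c j * ⟪p i, q j⟫_ℝ := by
    simp only [sum_inner, inner_sum, real_inner_smul_left, real_inner_smul_right]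
    rw [Finset.sum_comm]
    exact Finset.sum_congr rfl fun i _ => Finset.sum_congr rfl fun j _ => by ring
  have e4 : ∑ i, ∑ j, c j * c i * ⟪p j, q i⟫_ℝ = ∑ i, ∑ j, c i * c j * ⟪p i, q j⟫_ℝ :=
    Finset.sum_comm
  simp only [e, Finset.sum_sub_distrib, Finset.sum_add_distrib] at h0
  rw [e1, e2, e4, ← e3] at h0
  linarith

/-- The Debrunner–Flor extension property for finite monotone families. -/
theorem exists_monotonically_related {ι : Type*} [Fintype ι] [Nonempty ι] (p q : ι → X)
    (h : ∀ i j, 0 ≤ ⟪p i - p j, q i - q j⟫_ℝ) {ε : ℝ} (hε : 0 ≤ ε) (w : X) :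
    ∃ y, ∀ i, 0 ≤ ⟪y - p i, w - ε • y - q i⟫_ℝ := by
  classical
  -- For `c` in the simplex this is the `c`-average of `-⟪y - p i, w - ε • y - q i⟫`: convex in `y`,
  -- affine in `c`.
  let f : X → (ι → ℝ) → ℝ := fun y c =>
    ε * ‖y‖ ^ 2 + ∑ i, c i * (⟪y, q i - ε • p i - w⟫_ℝ - ⟪p i, q i - w⟫_ℝ)
  have hcont : Continuous fun z : X × (ι → ℝ) => f z.1 z.2 := by fun_prop
  obtain ⟨a, ha, b, hb, hab⟩ := Sion.exists_isSaddlePointOn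
    (X := convexHull ℝ (Set.range p)) (Y := stdSimplex ℝ ι) (f := f)
    (Set.range_nonempty p).convexHull (convex_convexHull ℝ _)
    ((Set.finite_range p).isCompact_convexHull ℝ)
    (fun c _ => (Continuous.lowerSemicontinuous
      (hcont.comp (Continuous.prodMk_left c))).lowerSemicontinuousOn _)
    (fun c _ => by
      refine ConvexOn.quasiconvexOn (ConvexOn.add ?_ ?_)
      · exact (((convexOn_norm (convex_convexHull ℝ (Set.range p))).pow
          (fun _ _ => norm_nonneg _) 2)).smul hε
      · refine ⟨convex_convexHull ℝ _, fun x _ y _ s t _ _ hst => le_of_eq ?_⟩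
        simp only [smul_eq_mul, Finset.mul_sum, ← Finset.sum_add_distrib]
        refine Finset.sum_congr rfl fun i _ => ?_
        simp only [inner_add_left, real_inner_smul_left]
        obtain rfl : t = 1 - s := by linarith
        ring)
    (convex_stdSimplex ℝ ι) ⟨Pi.single (Classical.arbitrary ι) 1, single_mem_stdSimplex ℝ _⟩
    (isCompact_stdSimplex ℝ ι)
    (fun y _ => (Continuous.upperSemicontinuous
      (hcont.comp (Continuous.prodMk_right y))).upperSemicontinuousOn _)
    (fun y _ => by
      refine ConcaveOn.quasiconcaveOn ⟨convex_stdSimplex ℝ ι, fun c _ d _ s t _ _ hst => le_of_eq ?_⟩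
      simp only [f, smul_eq_mul, mul_add, Finset.mul_sum, Pi.add_apply, Pi.smul_apply, add_mul,
        Finset.sum_add_distrib, mul_assoc]
      obtain rfl : t = 1 - s := by linarith
      ring)
  refine ⟨a, fun i => ?_⟩
  have hm : ∑ i, b i • p i ∈ convexHull ℝ (Set.range p) :=
    (convex_convexHull ℝ _).sum_mem (fun i _ => hb.1 i) hb.2
      fun i _ => subset_convexHull ℝ _ ⟨i, rfl⟩
  have h1 := hab _ hm _ (single_mem_stdSimplex ℝ i)
  -- At the barycentre of the `p i` the terms in `ε` and `w` cancel, leaving the Chebyshev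
  -- difference.
  have h2 : f (∑ i, b i • p i) b ≤ 0 := by
    have hch := inner_sum_le_sum_inner p q b hb h
    set m := ∑ i, b i • p i with hmdef
    have : ∑ i, b i * (⟪m, q i - ε • p i - w⟫_ℝ - ⟪p i, q i - w⟫_ℝ) =
        ⟪m, ∑ i, b i • q i⟫_ℝ - ε * ⟪m, m⟫_ℝ - ⟪m, w⟫_ℝ
          - ∑ i, b i * ⟪p i, q i⟫_ℝ + ⟪m, w⟫_ℝ := by
      have e1 : ⟪m, m⟫_ℝ = ∑ i, b i * ⟪m, p i⟫_ℝ := by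
        conv_lhs => rw [hmdef]
        rw [← hmdef, real_inner_comm]
        conv_lhs => rw [hmdef, real_inner_comm, sum_inner]
        simp only [real_inner_smul_left, ← hmdef]
        simp only [real_inner_comm]
      have e2 : ∑ i, b i * ⟪p i, w⟫_ℝ = ⟪m, w⟫_ℝ := by
        simp only [hmdef, sum_inner, real_inner_smul_left]
      have e3 : ∑ i, b i * ⟪m, w⟫_ℝ = ⟪m, w⟫_ℝ := by rw [← Finset.sum_mul, hb.2, one_mul]
      rw [e1, ← e2]
      nth_rewrite 1 [e2]
      rw [← e3]
      simp only [inner_sum, real_inner_smul_right, Finset.mul_sum, ← Finset.sum_sub_distrib,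
        ← Finset.sum_add_distrib]
      refine Finset.sum_congr rfl fun i _ => ?_
      simp only [inner_sub_right, real_inner_smul_right]
      ring
    simp only [f]
    rw [this, ← real_inner_self_eq_norm_sq]
    linarith
  have h3 : f a (Pi.single i 1) = -⟪a - p i, w - ε • a - q i⟫_ℝ := by
    simp only [f, Pi.single_apply, ite_mul, one_mul, zero_mul, Finset.sum_ite_eq',
      Finset.mem_univ, if_true, ← real_inner_self_eq_norm_sq, inner_sub_left, inner_sub_right,
      real_inner_smul_right]
    rw [real_inner_comm (p i) a]
    ring
  linarith

/-- Minty's theorem: `M + ε Id` is surjective for a maximally monotone `M`. -/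
theorem IsMaximallyMonotone.exists_sub_smul_mem [FiniteDimensional ℝ X]
    (hM : IsMaximallyMonotone M) {ε : ℝ} (hε : 0 < ε) (w : X) : ∃ x, w - ε • x ∈ M x := by
  obtain ⟨p₀, hp₀⟩ := hM.graph_nonempty
  let t : graph M → Set X := fun p => {y | 0 ≤ ⟪y - p.1.1, w - ε • y - p.1.2⟫_ℝ}
  have ht : ∀ p, IsClosed (t p) := fun p => isClosed_le (by fun_prop) (by fun_prop)
  have hbdd : Bornology.IsBounded (t ⟨p₀, hp₀⟩) := by
    obtain ⟨x₀, u₀⟩ := p₀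
    -- `c` dominates the linear and constant terms, so `-ε * ‖y‖ ^ 2` wins once `‖y‖ > c / ε + 1`.
    set c := ‖w - u₀ + ε • x₀‖ + ‖x₀‖ * ‖w - u₀‖ + 1 with hc
    refine (Metric.isBounded_closedBall (x := (0 : X)) (r := c / ε + 1)).subset fun y hy => ?_
    rw [mem_closedBall_zero_iff]
    have hy : 0 ≤ ⟪y - x₀, w - ε • y - u₀⟫_ℝ := hy
    have e : ⟪y - x₀, w - ε • y - u₀⟫_ℝ =
        ⟪y, w - u₀ + ε • x₀⟫_ℝ - ⟪x₀, w - u₀⟫_ℝ - ε * ‖y‖ ^ 2 := by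
      simp only [← real_inner_self_eq_norm_sq, inner_sub_left, inner_sub_right, inner_add_right,
        real_inner_smul_right]
      rw [real_inner_comm y x₀]
      ring
    have h1 := real_inner_le_norm y (w - u₀ + ε • x₀)
    have h2 := neg_le_of_abs_le (abs_real_inner_le_norm x₀ (w - u₀))
    by_contra! hlt
    have hc0 : 0 < c := by positivity
    have h3 : c + ε < ε * ‖y‖ := by
      have := mul_lt_mul_of_pos_left hlt hε
      rwa [mul_add, mul_div_cancel₀ _ hε.ne', mul_one] at this
    have hy1 : 1 < ‖y‖ := by
      have : 0 < c / ε := by positivity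
      linarith
    have h4 : (c + ε) * ‖y‖ < ε * ‖y‖ * ‖y‖ := mul_lt_mul_of_pos_right h3 (by linarith)
    have h5 : 0 ≤ (‖x₀‖ * ‖w - u₀‖) * (‖y‖ - 1) := mul_nonneg (by positivity) (by linarith)
    have h6 : 0 < ε * ‖y‖ := by positivity
    rw [hc] at h4
    nlinarith
  obtain ⟨y, -, hy⟩ := (Metric.isCompact_of_isClosed_isBounded (ht _) hbdd).inter_iInter_nonempty
    t ht fun u => by
      classical
      have : Nonempty (insert (⟨p₀, hp₀⟩ : graph M) u : Finset _) :=
        ⟨⟨_, Finset.mem_insert_self _ _⟩⟩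
      obtain ⟨y, hy⟩ := exists_monotonically_related
        (ι := (insert (⟨p₀, hp₀⟩ : graph M) u : Finset _)) (fun i => i.1.1.1) (fun i => i.1.1.2)
        (fun i j => hM.1 _ i.1.2 _ j.1.2) hε.le w
      refine ⟨y, hy ⟨_, Finset.mem_insert_self _ _⟩, Set.mem_iInter₂.2 fun i hi => ?_⟩
      exact hy ⟨i, Finset.mem_insert_of_mem hi⟩
  exact ⟨y, hM.mem_of_monotonically_related fun p hp => Set.mem_iInter.1 hy ⟨p, hp⟩⟩

/-! ### The projected Fitzpatrick domain and the sum -/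

/-- The projection of the domain of the Fitzpatrick function of `M` to the range space. -/
def fitzpatrickRange (M : X → Set X) : Set X :=
  {w | ∃ x C, ∀ p ∈ graph M, ⟪x, p.2⟫_ℝ + ⟪p.1, w⟫_ℝ - ⟪p.1, p.2⟫_ℝ ≤ (C : ℝ)}

theorem convex_fitzpatrickRange : Convex ℝ (fitzpatrickRange M) := by
  rintro w ⟨x, C, h⟩ w' ⟨x', C', h'⟩ a b ha hb hab
  refine ⟨a • x + b • x', a * C + b * C', fun p hp => ?_⟩
  have h1 := mul_le_mul_of_nonneg_left (h p hp) ha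
  have h2 := mul_le_mul_of_nonneg_left (h' p hp) hb
  simp only [inner_add_left, inner_add_right, real_inner_smul_left, real_inner_smul_right]
  obtain rfl : b = 1 - a := by linarith
  linarith

theorem IsMonotone.fitzpatrick_le (hM : IsMonotone M) {x u : X} (hu : u ∈ M x) :
    ∀ p ∈ graph M, ⟪x, p.2⟫_ℝ + ⟪p.1, u⟫_ℝ - ⟪p.1, p.2⟫_ℝ ≤ ⟪x, u⟫_ℝ := by
  intro p hp
  have := hM (x, u) hu p hp
  simp only [inner_sub_left, inner_sub_right] at this
  linarith

theorem IsMonotone.ran_subset_fitzpatrickRange (hM : IsMonotone M) :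
    ran M ⊆ fitzpatrickRange M := by
  intro u hu
  obtain ⟨x, hx⟩ := Set.mem_iUnion.1 hu
  exact ⟨x, _, hM.fitzpatrick_le hx⟩

theorem IsRectangular.exists_bound (hA : IsRectangular A) {x u : X} (hx : x ∈ dom A)
    (hu : u ∈ ran A) :
    ∃ C : ℝ, ∀ p ∈ graph A, ⟪x, p.2⟫_ℝ + ⟪p.1, u⟫_ℝ - ⟪p.1, p.2⟫_ℝ ≤ C := by
  have h : fitzpatrick A (x, u) < ⊤ := hA ⟨hx, hu⟩
  obtain ⟨C, hC, -⟩ := EReal.lt_iff_exists_real_btwn.1 h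
  refine ⟨C, fun p hp => EReal.coe_le_coe_iff.1 (le_trans ?_ hC.le)⟩
  exact le_iSup₂ (f := fun (p : X × X) (_ : p ∈ graph A) =>
    ((⟪x, p.2⟫_ℝ + ⟪p.1, u⟫_ℝ - ⟪p.1, p.2⟫_ℝ : ℝ) : EReal)) p hp

theorem add_mem_fitzpatrickRange_add {x u v : X} {C D : ℝ}
    (hA : ∀ p ∈ graph A, ⟪x, p.2⟫_ℝ + ⟪p.1, u⟫_ℝ - ⟪p.1, p.2⟫_ℝ ≤ C)
    (hB : ∀ p ∈ graph B, ⟪x, p.2⟫_ℝ + ⟪p.1, v⟫_ℝ - ⟪p.1, p.2⟫_ℝ ≤ D) :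
    u + v ∈ fitzpatrickRange (A + B) := by
  refine ⟨x, C + D, ?_⟩
  rintro ⟨y, z⟩ ⟨a, ha, b, hb, rfl⟩
  have h1 := hA (y, a) ha
  have h2 := hB (y, b) hb
  simp only [inner_add_right] at h1 h2 ⊢
  linarith

theorem ran_add_subset : ran (A + B) ⊆ ran A + ran B := by
  intro w hw
  obtain ⟨x, a, ha, b, hb, rfl⟩ := Set.mem_iUnion.1 hw
  exact ⟨a, Set.mem_iUnion.2 ⟨x, ha⟩, b, Set.mem_iUnion.2 ⟨x, hb⟩, rfl⟩

theorem ran_add_ran_subset_of_isRectangular (hA : IsRectangular A) (hB : IsRectangular B)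
    (h : (graph (A + B)).Nonempty) : ran A + ran B ⊆ fitzpatrickRange (A + B) := by
  obtain ⟨⟨x, z⟩, a, ha, b, hb, -⟩ := h
  rintro _ ⟨u, hu, v, hv, rfl⟩
  obtain ⟨C, hC⟩ := hA.exists_bound ⟨a, ha⟩ hu
  obtain ⟨D, hD⟩ := hB.exists_bound ⟨b, hb⟩ hv
  exact add_mem_fitzpatrickRange_add hC hD

/-- Taking `x` with `u ∈ A x`, monotonicity alone bounds `F_A (x, u)`, and `x ∈ dom B` lets
rectangularity bound `F_B (x, v)`. -/
theorem ran_add_ran_subset_of_dom_subset (hA : IsMonotone A) (hB : IsRectangular B)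
    (h : dom A ⊆ dom B) : ran A + ran B ⊆ fitzpatrickRange (A + B) := by
  rintro _ ⟨u, hu, v, hv, rfl⟩
  obtain ⟨x, hx⟩ := Set.mem_iUnion.1 hu
  obtain ⟨D, hD⟩ := hB.exists_bound (h ⟨u, hx⟩) hv
  exact add_mem_fitzpatrickRange_add (hA.fitzpatrick_le hx) hD

/-! ### Relative interior points are attained -/

/-- Values of a maximally monotone operator are unchanged by translations orthogonal to the
affine hull of its range. -/
theorem IsMaximallyMonotone.mem_of_sub_mem_orthogonal (hM : IsMaximallyMonotone M)
    {V : Submodule ℝ X} (hV : ∀ u ∈ ran M, ∀ v ∈ ran M, u - v ∈ V) {x y u : X} (hu : u ∈ M x)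
    (hxy : y - x ∈ Vᗮ) : u ∈ M y := by
  refine hM.mem_of_monotonically_related fun p hp => ?_
  have h1 := hM.1 (x, u) hu p hp
  have h2 : ⟪y - x, u - p.2⟫_ℝ = 0 :=
    Submodule.inner_left_of_mem_orthogonal
      (hV _ (Set.mem_iUnion.2 ⟨x, hu⟩) _ (Set.mem_iUnion.2 ⟨p.1, hp⟩)) hxy
  have : y - p.1 = (x - p.1) + (y - x) := by abel
  rw [this, inner_add_left, h2, add_zero]
  exact h1

/-- The Fitzpatrick bound is tested at `(y, w - ε • y)`, and Young's inequality absorbs `ε * ⟪x,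
y⟫`. Taking `z = w` controls `ε * ‖y‖ ^ 2`; taking `z = w + c • v` controls `⟪y, v⟫`. -/
theorem inner_le_of_sub_smul_mem {x z w y : X} {C ε : ℝ} (hε : 0 < ε) (hε1 : ε ≤ 1)
    (h : ∀ p ∈ graph M, ⟪x, p.2⟫_ℝ + ⟪p.1, z⟫_ℝ - ⟪p.1, p.2⟫_ℝ ≤ C)
    (hy : w - ε • y ∈ M y) :
    ⟪y, z - w⟫_ℝ + ε / 2 * ‖y‖ ^ 2 ≤ C - ⟪x, w⟫_ℝ + ‖x‖ ^ 2 := by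
  have h1 := h (y, w - ε • y) hy
  simp only [inner_sub_right, real_inner_smul_right, real_inner_self_eq_norm_sq] at h1 ⊢
  have h2 := real_inner_le_norm x y
  have h3 : ε * ⟪x, y⟫_ℝ ≤ ε * (‖x‖ ^ 2 / 2 + ‖y‖ ^ 2 / 2) :=
    mul_le_mul_of_nonneg_left (by nlinarith [sq_nonneg (‖x‖ - ‖y‖)]) hε.le
  nlinarith [sq_nonneg ‖x‖]

theorem isBounded_range_of_inner_le {ι : Type*} {V : Submodule ℝ X} [CompleteSpace V] (y : ι → X)
    (hy : ∀ i, y i ∈ V) (h : ∀ v ∈ V, ∃ C : ℝ, ∀ i, ⟪y i, v⟫_ℝ ≤ C) :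
    Bornology.IsBounded (Set.range y) := by
  obtain ⟨C, hC⟩ := banach_steinhaus (g := fun i => innerSL ℝ (⟨y i, hy i⟩ : V)) fun v => by
    obtain ⟨C₁, h₁⟩ := h v v.2
    obtain ⟨C₂, h₂⟩ := h (-v : V) (-v).2
    refine ⟨max C₁ C₂, fun i => abs_le.2 ?_⟩
    have h₁ := h₁ i
    have h₂ := h₂ i
    simp only [Submodule.coe_neg, inner_neg_right] at h₂
    simp only [innerSL_apply_apply, Submodule.coe_inner]
    constructor
    · linarith [le_max_right C₁ C₂]
    · exact h₁.trans (le_max_left _ _)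
  refine isBounded_iff_forall_norm_le.2 ⟨C, ?_⟩
  rintro _ ⟨i, rfl⟩
  simpa [innerSL_apply_norm] using hC i

theorem IsMaximallyMonotone.intrinsicInterior_fitzpatrickRange_subset [FiniteDimensional ℝ X]
    (hM : IsMaximallyMonotone M) : intrinsicInterior ℝ (fitzpatrickRange M) ⊆ ran M := by
  intro w hw
  obtain ⟨hwa, r, hr, hb⟩ := mem_intrinsicInterior_iff_ball.1 hw
  set V := (affineSpan ℝ (fitzpatrickRange M)).direction with hVdef
  have hV : ∀ u ∈ ran M, ∀ v ∈ ran M, u - v ∈ V := fun u hu v hv =>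
    AffineSubspace.vsub_mem_direction
      (subset_affineSpan ℝ _ (hM.1.ran_subset_fitzpatrickRange hu))
      (subset_affineSpan ℝ _ (hM.1.ran_subset_fitzpatrickRange hv))
  let ε : ℕ → ℝ := fun n => 1 / ((n : ℝ) + 1)
  have hε : ∀ n, 0 < ε n := fun n => Nat.one_div_pos_of_nat
  have hε1 : ∀ n, ε n ≤ 1 := fun n => by
    simp only [ε]
    rw [div_le_one (by positivity)]
    linarith [n.cast_nonneg (α := ℝ)]
  have hεlim : Filter.Tendsto ε Filter.atTop (𝓝 0) := tendsto_one_div_add_atTop_nhds_zero_nat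
  choose x hx using fun n => hM.exists_sub_smul_mem (hε n) w
  have hlim : Filter.Tendsto (fun n => w - ε n • x n) Filter.atTop (𝓝 w) := by
    obtain ⟨z, C, hz⟩ := intrinsicInterior_subset hw
    suffices Filter.Tendsto (fun n => ε n • x n) Filter.atTop (𝓝 0) by
      simpa using this.const_sub w
    set K := C - ⟪z, w⟫_ℝ + ‖z‖ ^ 2
    refine squeeze_zero_norm (a := fun n => √(ε n * (2 * K))) (fun n => ?_) ?_
    · have := inner_le_of_sub_smul_mem (hε n) (hε1 n) hz (hx n)
      rw [sub_self, inner_zero_right, zero_add] at this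
      refine Real.le_sqrt_of_sq_le ?_
      rw [norm_smul, Real.norm_of_nonneg (hε n).le]
      nlinarith [hε n]
    · have := (hεlim.mul_const (2 * K)).sqrt
      simpa using this
  -- The Fitzpatrick bounds control `x n` only along `V`; dropping the orthogonal component keeps
  -- the values of `M`.
  let y : ℕ → X := fun n => V.starProjection (x n)
  have hy : ∀ n, w - ε n • x n ∈ M (y n) := fun n => by
    refine hM.mem_of_sub_mem_orthogonal hV (hx n) ?_
    rw [← neg_sub]
    exact neg_mem (V.sub_starProjection_mem_orthogonal (x n))
  have hbdd : Bornology.IsBounded (Set.range y) := by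
    refine isBounded_range_of_inner_le (V := V) y (fun n => V.starProjection_apply_mem _)
      fun v hv => ?_
    -- Relative interiority lets `w` move a little in any direction `v ∈ V`; this yields the
    -- pointwise bounds for Banach–Steinhaus.
    obtain ⟨c, hc, hcv⟩ : ∃ c : ℝ, 0 < c ∧ c * ‖v‖ < r := by
      refine ⟨r / (‖v‖ + 1), by positivity, ?_⟩
      rw [div_mul_eq_mul_div, div_lt_iff₀ (by positivity)]
      nlinarith
    have hmem : w + c • v ∈ fitzpatrickRange M := by
      refine hb _ ?_ ?_
      · rw [add_comm]
        exact AffineSubspace.vadd_mem_of_mem_direction (V.smul_mem c hv) hwa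
      · rwa [dist_eq_norm, add_sub_cancel_left, norm_smul, Real.norm_of_nonneg hc.le]
    obtain ⟨z, C, hz⟩ := hmem
    refine ⟨(C - ⟪z, w⟫_ℝ + ‖z‖ ^ 2) / c, fun n => ?_⟩
    have h1 := inner_le_of_sub_smul_mem (hε n) (hε1 n) hz (hx n)
    have h2 : ⟪y n, v⟫_ℝ = ⟪x n, v⟫_ℝ := by
      have := Submodule.inner_left_of_mem_orthogonal hv
        (V.sub_starProjection_mem_orthogonal (x n))
      rw [inner_sub_left] at this
      linarith
    rw [add_sub_cancel_left, real_inner_smul_right] at h1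
    rw [h2, le_div_iff₀ hc]
    have : 0 ≤ ε n / 2 * ‖x n‖ ^ 2 := mul_nonneg (by linarith [hε n]) (sq_nonneg _)
    linarith
  obtain ⟨a, -, φ, hφ, ha⟩ := tendsto_subseq_of_bounded hbdd fun n => Set.mem_range_self n
  exact Set.mem_iUnion.2 ⟨a, hM.mem_of_tendsto ha (hlim.comp hφ.tendsto_atTop) fun n => hy _⟩

end Monotone

end SetValued

/-- Here `A + B` is the pointwise sum `x ↦ A x + B x`, where `A x + B x` is the Minkowski sum. -/
theorem theorem3p12 {X : Type*} [NormedAddCommGroup X] [InnerProductSpace ℝ X]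
    [FiniteDimensional ℝ X] (A B : X → Set X)
    (hA : SetValued.IsMonotone A) (hB : SetValued.IsMonotone B)
    (hAB : SetValued.IsMaximallyMonotone (A + B))
    (h : (SetValued.IsRectangular A ∧ SetValued.IsRectangular B) ∨
      (SetValued.dom A ⊆ SetValued.dom B ∧ SetValued.IsRectangular B)) :
    SetValued.NearlyConvex (SetValued.ran (A + B)) ∧
      SetValued.NearlyEqual (SetValued.ran (A + B)) (SetValued.ran A + SetValued.ran B) := by
  have hD := SetValued.convex_fitzpatrickRange (M := A + B)
  have hri := hAB.intrinsicInterior_fitzpatrickRange_subset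
  have hRS := SetValued.ran_add_subset (A := A) (B := B)
  have hR := hAB.1.ran_subset_fitzpatrickRange
  have hS : SetValued.ran A + SetValued.ran B ⊆ SetValued.fitzpatrickRange (A + B) := by
    rcases h with ⟨h₁, h₂⟩ | ⟨h₁, h₂⟩
    · exact SetValued.ran_add_ran_subset_of_isRectangular h₁ h₂ hAB.graph_nonempty
    · exact SetValued.ran_add_ran_subset_of_dom_subset hA h₂ h₁
  refine ⟨⟨_, SetValued.convex_intrinsicInterior hD, hri,
    hR.trans (SetValued.subset_closure_intrinsicInterior hD)⟩, ?_, ?_⟩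
  · rw [SetValued.closure_eq_of_intrinsicInterior_subset hD hri hR,
      SetValued.closure_eq_of_intrinsicInterior_subset hD (hri.trans hRS) hS]
  · rw [SetValued.intrinsicInterior_eq_of_subset_of_subset hD hri hR,
      SetValued.intrinsicInterior_eq_of_subset_of_subset hD (hri.trans hRS) hS]
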